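/- Let $(T,\mathcal A,\mu)$ be a $\sigma$-finite (non-negative, countably additive) measure space and $X$ a real Banach space. Let $b(X)$ be the family of nonempty bounded subsets of $X$ and $cwk(X)$ the family of nonempty convex weakly compact subsets of $X$, with the Hausdorff distance $h$; for $C\in cwk(X)$ and $x^*\in X^*$ put $s(x^*,C)=\sup_{x\in C}\langle x^*,x\rangle$. Let $\mathcal C\subseteq b(X)$ (for instance $\mathcal C=cwk(X)$) and suppose that $F:T\to cwk(X)$ is simple-Birkhoff integrable in $\mathcal C$, i.e. there is a closed set $I\in\mathcal C$ such that for every $\varepsilon>0$ there is a countable (possibly finite) partition $P_\varepsilon\subset\mathcal A$ of $T$ into sets of finite measure such that for every countable measurable partition $\{A_n\}_n$ of $T$ finer than $P_\varepsilon$, in every enumeration, and all $t_n\in A_n$, $$\limsup_n h\Big(\overline{\textstyle\sum_{i=1}^n \mu(A_i)F(t_i)},\,I\Big)\le\varepsilon$$ (for a finite partition, the full sum takes the place of the $\limsup$ of partial sums). Then $F$ and $j\circ F$ are Pettis integrable, where $j$ is the Rådström embedding of $cwk(X)$. Explicitly: 1. $F$ is Pettis integrable: $s(x^*,F(\cdot))$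 is $\mu$-integrable for every $x^*\in X^*$, and for every $A\in\mathcal A$ there is $C_A\in cwk(X)$ with $s(x^*,C_A)=\int_A s(x^*,F)\,d\mu$ for all $x^*\in X^*$. 2. $j\circ F$ is Pettis integrable for the embedding $j:cwk(X)\to\ell^\infty(B_{X^*})$, $j(C)=(s(x^*,C))_{x^*\in B_{X^*}}$, where $B_{X^*}$ is the closed unit ball of $X^*$, and also for every compact Hausdorff space $\Omega$ and every map $j:cwk(X)\to C(\Omega)$ such that $j(\alpha A+\beta C)=\alpha j(A)+\beta j(C)$ for $\alpha,\beta\ge0$, $h(A,C)=\|j(A)-j(C)\|_\infty$, $j(cwk(X))$ is norm closed, and $j(\mathrm{co}(A\cup C))=\max\{j(A),j(C)\}$ for all $A,C\in cwk(X)$. Here a function $f:T\to Y$ into a Banach space is Pettis integrable if $\langle y^*,f\rangle$ is $\mu$-integrable for every $y^*\in Y^*$ and for every $A\in\mathcal A$ there is $y_A\in Y$ with $\langle y^*,y_A\rangle=\int_A\langle y^*,f\rangle\,d\mu$ for all $y^*\in Y^*$. -/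

import Mathlib

open MeasureTheory Set Filter
open scoped ENNReal Pointwise

/-- `cwk(X)`: the family of all nonempty convex weakly compact subsets of `X`. -/
abbrev Cwk (X : Type*) [NormedAddCommGroup X] [NormedSpace ℝ X] : Type _ :=
  {C : Set X // C.Nonempty ∧ Convex ℝ C ∧ IsCompact (toWeakSpace ℝ X '' C)}

/-- `b(X)`: the family of all nonempty bounded subsets of `X`. -/
def boundedSets (X : Type*) [NormedAddCommGroup X] : Set (Set X) :=
  {C | C.Nonempty ∧ Bornology.IsBounded C}

/-- The support function `s(x', C) = sup {x'(x) : x ∈ C}`. -/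
noncomputable def supportFun {X : Type*} [NormedAddCommGroup X] [NormedSpace ℝ X]
    (x' : StrongDual ℝ X) (C : Set X) : ℝ :=
  sSup ((fun x => x' x) '' C)

/-- A countable measurable partition of `T`, enumerated as a sequence. Empty members are allowed in
the sequence, so that finite partitions are covered too. Empty members do not influence the
Riemann sums below, since they have measure zero. -/
structure IsCountablePartition {T : Type*} [MeasurableSpace T] (A : ℕ → Set T) : Prop where
  measurableSet : ∀ n, MeasurableSet (A n)
  pairwise_disjoint : Pairwise (fun m n => Disjoint (A m) (A n))
  iUnion_eq : (⋃ n, A n) = Set.univ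

/-- The partition `B` is finer than the partition `A`: every set of `B` is contained in some set
of `A`. -/
def IsFinerThan {T : Type*} (B A : ℕ → Set T) : Prop :=
  ∀ n, ∃ m, B n ⊆ A m

/-- The tags `t` are subordinate to the sequence `A`: `t n ∈ A n` for every nonempty `A n`. -/
def IsTagging {T : Type*} (t : ℕ → T) (A : ℕ → Set T) : Prop :=
  ∀ n, (A n).Nonempty → t n ∈ A n

/-- The `n`-th partial Riemann sum of a multifunction: the norm closure of the Minkowski sum
of the sets `μ(A i) F(t i)`, `i < n`. -/
noncomputable def riemannSum {T X : Type*} [MeasurableSpace T] [NormedAddCommGroup X]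
    [NormedSpace ℝ X] (μ : Measure T) (F : T → Set X) (A : ℕ → Set T) (t : ℕ → T) (n : ℕ) :
    Set X :=
  closure (∑ i ∈ Finset.range n, μ.real (A i) • F (t i))

/-- Simple-Birkhoff integrability of a multifunction `F`, with integral in the family `𝒞`.
The sets of the partition `A` have finite measure, so the same is true of every finer partition,
and the coefficients `μ.real (B i)` in the sums are the actual measures. The Hausdorff distance is
taken in `[0, ∞]`, so that the `limsup` is always meaningful. -/
def IsSimpleBirkhoffIntegrable {T X : Type*} [MeasurableSpace T] [NormedAddCommGroup X]
    [NormedSpace ℝ X] (μ : Measure T) (𝒞 : Set (Set X)) (F : T → Set X) : Prop :=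
  ∃ I ∈ 𝒞, IsClosed I ∧ ∀ ε : ℝ, 0 < ε →
    ∃ A : ℕ → Set T, IsCountablePartition A ∧ (∀ n, μ (A n) < ∞) ∧
      ∀ B : ℕ → Set T, IsCountablePartition B → IsFinerThan B A →
        ∀ t : ℕ → T, IsTagging t B →
          limsup (fun n => Metric.hausdorffEDist (riemannSum μ F B t n) I) atTop
            ≤ ENNReal.ofReal ε

/-- Pettis integrability of a single-valued function. -/
def IsPettisIntegrable {T Y : Type*} [MeasurableSpace T] [NormedAddCommGroup Y]
    [NormedSpace ℝ Y] (μ : Measure T) (f : T → Y) : Prop :=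
  (∀ y' : StrongDual ℝ Y, Integrable (fun t => y' (f t)) μ) ∧
    ∀ A : Set T, MeasurableSet A →
      ∃ y : Y, ∀ y' : StrongDual ℝ Y, y' y = ∫ t in A, y' (f t) ∂μ

/-- Pettis integrability of a `cwk(X)`-valued multifunction. -/
def IsMultiPettisIntegrable {T X : Type*} [MeasurableSpace T] [NormedAddCommGroup X]
    [NormedSpace ℝ X] (μ : Measure T) (F : T → Cwk X) : Prop :=
  (∀ x' : StrongDual ℝ X, Integrable (fun t => supportFun x' (F t).1) μ) ∧
    ∀ A : Set T, MeasurableSet A →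
      ∃ C : Cwk X, ∀ x' : StrongDual ℝ X,
        supportFun x' C.1 = ∫ t in A, supportFun x' (F t).1 ∂μ

theorem Cwk.exists_norm_le {X : Type*} [NormedAddCommGroup X] [NormedSpace ℝ X] (C : Cwk X) :
    ∃ M : ℝ, ∀ x ∈ C.1, ‖x‖ ≤ M := by
  have h : ∀ x' : StrongDual ℝ X, ∃ M : ℝ, ∀ x : C.1,
      ‖NormedSpace.inclusionInDoubleDual ℝ X (x : X) x'‖ ≤ M := by
    intro x'
    have hc : Continuous (fun x : WeakSpace ℝ X => x' ((toWeakSpace ℝ X).symm x)) :=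
      WeakBilin.eval_continuous (topDualPairing ℝ X).flip x'
    obtain ⟨M, hM⟩ := C.2.2.2.exists_bound_of_continuousOn hc.continuousOn
    refine ⟨M, fun x => ?_⟩
    simpa using hM (toWeakSpace ℝ X x) ⟨x, x.2, rfl⟩
  obtain ⟨M, hM⟩ := banach_steinhaus h
  refine ⟨M, fun x hx => ?_⟩
  rw [← (NormedSpace.inclusionInDoubleDualLi ℝ (E := X)).norm_map x]
  exact hM ⟨x, hx⟩

theorem Cwk.memℓp_supportFun {X : Type*} [NormedAddCommGroup X] [NormedSpace ℝ X] (C : Cwk X) :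
    Memℓp (fun x' : Metric.closedBall (0 : StrongDual ℝ X) 1 => supportFun x'.1 C.1) ∞ := by
  obtain ⟨M, hM⟩ := C.exists_norm_le
  obtain ⟨x₀, hx₀⟩ := C.2.1
  refine memℓp_infty ⟨M, ?_⟩
  rintro _ ⟨x', rfl⟩
  have hx' : ‖x'.1‖ ≤ 1 := mem_closedBall_zero_iff.1 x'.2
  have key : ∀ x ∈ C.1, |x'.1 x| ≤ M := fun x hx =>
    calc |x'.1 x| ≤ ‖x'.1‖ * ‖x‖ := x'.1.le_opNorm x
      _ ≤ 1 * ‖x‖ := by gcongr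
      _ ≤ M := by simpa using hM x hx
  have hbdd : BddAbove ((fun x => x'.1 x) '' C.1) := by
    refine ⟨M, ?_⟩
    rintro _ ⟨x, hx, rfl⟩
    exact (abs_le.1 (key x hx)).2
  change |supportFun x'.1 C.1| ≤ M
  rw [abs_le]
  constructor
  · exact (abs_le.1 (key x₀ hx₀)).1.trans (le_csSup hbdd ⟨x₀, hx₀, rfl⟩)
  · refine csSup_le ⟨_, x₀, hx₀, rfl⟩ ?_
    rintro _ ⟨x, hx, rfl⟩
    exact (abs_le.1 (key x hx)).2

/-- The classical Rådström embedding of `cwk(X)` into `ℓ^∞(B)`, where `B` is the closed unit ball of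
the dual space of `X`: it sends `C` to its support function `x' ↦ s(x', C)`. -/
noncomputable def radstromEmbedding {X : Type*} [NormedAddCommGroup X] [NormedSpace ℝ X]
    (C : Cwk X) : lp (fun _ : Metric.closedBall (0 : StrongDual ℝ X) 1 => ℝ) ∞ :=
  ⟨fun x' => supportFun x'.1 C.1, C.memℓp_supportFun⟩

/-- `j` is a Rådström embedding of `cwk(X)` into `C(Ω)`. The operations of `cwk(X)` occurring here,
`α A + β C` and `co (A ∪ C)`, always lead to elements of `cwk(X)`; the element obtained is
called `D`. -/
structure IsRadstromEmbedding {X Ω : Type*} [NormedAddCommGroup X] [NormedSpace ℝ X]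
    [TopologicalSpace Ω] [CompactSpace Ω] (j : Cwk X → C(Ω, ℝ)) : Prop where
  map_combination : ∀ (α β : ℝ), 0 ≤ α → 0 ≤ β → ∀ A C D : Cwk X,
    D.1 = α • A.1 + β • C.1 → j D = α • j A + β • j C
  isometry : ∀ A C : Cwk X, Metric.hausdorffDist A.1 C.1 = ‖j A - j C‖
  isClosed_range : IsClosed (Set.range j)
  map_convexHull_union : ∀ A C D : Cwk X,
    D.1 = convexHull ℝ (A.1 ∪ C.1) → j D = j A ⊔ j C

/-! The Rådström embedding `j` turns Minkowski combinations into linear ones and does not increase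
distances, so `j ∘ F` satisfies the same Riemann-sum condition in norm, in a Banach space `Y`
(`exists_hasSimpleBirkhoffIntegral`). It remains to treat single-valued functions and then to return
to sets.

For single-valued `f`, convergence in every enumeration is unordered convergence
(`ApproxByRiemannSums.exists_finset`). Comparing two taggings of one partition bounds the
oscillation of `y' ∘ f` in the mean, so `y' ∘ f` is an L¹ limit of countably valued functions, with
error at most a multiple of `ε * ‖y'‖`. Hence one finite combination of values of `f` approximates
the integrals over `E` of all `y' ∘ f` at once (`HasSimpleBirkhoffIntegral.exists_approx`), and
completeness of `Y` yields the Pettis integral.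

For `F` itself, these combinations have nonnegative coefficients, so they are images of sets in
`cwk(X)`. Their support functions converge uniformly on the dual ball, and the limit is again a
support function (`Cwk.exists_supportFun_eq`). -/

/-- Every Riemann sum of `f` over a countable partition finer than `A` is eventually within `ε`
of `v`. -/
def ApproxByRiemannSums {T Y : Type*} [MeasurableSpace T] [NormedAddCommGroup Y]
    [NormedSpace ℝ Y] (μ : Measure T) (f : T → Y) (v : Y) (ε : ℝ) (A : ℕ → Set T) : Prop :=
  ∀ B : ℕ → Set T, IsCountablePartition B → IsFinerThan B A → ∀ t : ℕ → T, IsTagging t B →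
    ∀ᶠ n in atTop, ‖∑ i ∈ Finset.range n, μ.real (B i) • f (t i) - v‖ ≤ ε

/-! ### Re-enumeration of partitions and unordered Riemann sums -/

/-- An enumeration with gaps that lists `S 0`, then what `S 1` adds, and so on. Stage `m` owns a
block of length `(S m).sup id + 1`, long enough to place `i` at offset `i`. The unused positions are
later filled with empty sets. -/
theorem exists_injective_lt_iff_mem (S : ℕ → Finset ℕ) (hmono : Monotone S)
    (hex : ∀ i, ∃ k, i ∈ S k) :
    ∃ φ : ℕ → ℕ, Function.Injective φ ∧ ∃ N : ℕ → ℕ, StrictMono N ∧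
      ∀ K i, φ i < N K ↔ i ∈ S K := by
  classical
  let k : ℕ → ℕ := fun i => Nat.find (hex i)
  have hk : ∀ i, i ∈ S (k i) := fun i => Nat.find_spec (hex i)
  let L : ℕ → ℕ := fun m => ∑ j ∈ Finset.range m, ((S j).sup id + 1)
  have hL : StrictMono L := strictMono_nat_of_lt_succ fun m => by
    simp only [L, Finset.sum_range_succ]; omega
  have hlt : ∀ i, L (k i) + i < L (k i + 1) := fun i => by
    have : i ≤ (S (k i)).sup id := Finset.le_sup (f := id) (hk i)
    simp only [L, Finset.sum_range_succ]; omega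
  refine ⟨fun i => L (k i) + i, ?_, fun K => L (K + 1), fun a b h => hL (by omega), ?_⟩
  · intro i i' h
    simp only at h
    have : k i = k i' := by
      rcases lt_trichotomy (k i) (k i') with hc | hc | hc
      · have := hL.monotone (show k i + 1 ≤ k i' by omega)
        have := hlt i
        omega
      · exact hc
      · have := hL.monotone (show k i' + 1 ≤ k i by omega)
        have := hlt i'
        omega
    rw [this] at h
    omega
  · intro K i
    constructor
    · intro h
      by_contra hi
      have : K < k i := by
        by_contra hc
        exact hi (hmono (not_lt.1 hc) (hk i))
      have := hL.monotone (show K + 1 ≤ k i by omega)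
      simp only at h
      omega
    · intro hi
      have h1 : k i ≤ K := Nat.find_min' (hex i) hi
      have := hL.monotone (show k i + 1 ≤ K + 1 by omega)
      have := hlt i
      simp only
      omega

theorem IsFinerThan.refl {T : Type*} (A : ℕ → Set T) : IsFinerThan A A :=
  fun n => ⟨n, subset_rfl⟩

section

variable {T Y : Type*} [MeasurableSpace T] [NormedAddCommGroup Y] [NormedSpace ℝ Y]
  {μ : Measure T} {f : T → Y} {v : Y} {ε : ℝ} {A : ℕ → Set T}

theorem ApproxByRiemannSums.of_isFinerThan {B : ℕ → Set T} (h : ApproxByRiemannSums μ f v ε A)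
    (hB : IsFinerThan B A) : ApproxByRiemannSums μ f v ε B := by
  intro C hC hCB
  refine h C hC fun n => ?_
  obtain ⟨m, hm⟩ := hCB n
  obtain ⟨l, hl⟩ := hB m
  exact ⟨l, hm.trans hl⟩

theorem IsCountablePartition.extend (hA : IsCountablePartition A) {φ : ℕ → ℕ}
    (hφ : Function.Injective φ) :
    IsCountablePartition (Function.extend φ A fun _ => ∅) where
  measurableSet n := by
    by_cases h : ∃ i, φ i = n
    · obtain ⟨i, rfl⟩ := h
      rw [hφ.extend_apply]
      exact hA.measurableSet i
    · rw [Function.extend_apply' _ _ _ h]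
      exact MeasurableSet.empty
  pairwise_disjoint m n hmn := by
    by_cases h : ∃ i, φ i = m
    · by_cases h' : ∃ i, φ i = n
      · obtain ⟨i, rfl⟩ := h
        obtain ⟨i', rfl⟩ := h'
        simp only [hφ.extend_apply]
        exact hA.pairwise_disjoint fun hc => hmn (by rw [hc])
      · simp [Function.extend_apply' _ _ _ h']
    · simp [Function.extend_apply' _ _ _ h]
  iUnion_eq := by
    rw [eq_univ_iff_forall]
    intro x
    obtain ⟨i, hi⟩ := mem_iUnion.1 (hA.iUnion_eq ▸ mem_univ x)
    exact mem_iUnion.2 ⟨φ i, by rwa [hφ.extend_apply]⟩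

/-- Riemann sums close to `v` in every enumeration are close to `v` in the unordered sense. -/
theorem ApproxByRiemannSums.exists_finset (h : ApproxByRiemannSums μ f v ε A)
    (hA : IsCountablePartition A) {t : ℕ → T} (ht : IsTagging t A) :
    ∃ S₀ : Finset ℕ, ∀ S, S₀ ⊆ S → ‖∑ i ∈ S, μ.real (A i) • f (t i) - v‖ ≤ ε := by
  classical
  by_contra! hc
  choose bad hsub hbad using hc
  -- Bad sets are nested, and index `k` is inserted at stage `k`, so that they exhaust `ℕ`. Listing
  -- them in turn gives an enumeration whose partial sums at the times `N K` are all bad.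
  let S : ℕ → Finset ℕ := fun k => Nat.rec (bad ∅) (fun k s => bad (insert k s)) k
  have hS : ∀ k, S (k + 1) = bad (insert k (S k)) := fun k => rfl
  have hSbad : ∀ k, ε < ‖∑ i ∈ S k, μ.real (A i) • f (t i) - v‖ := fun k => by
    cases k with
    | zero => exact hbad ∅
    | succ k => rw [hS]; exact hbad _
  have hmono : Monotone S := monotone_nat_of_le_succ fun k => by
    rw [hS]; exact (Finset.subset_insert _ _).trans (hsub _)
  obtain ⟨φ, hφ, N, hN, hφN⟩ := exists_injective_lt_iff_mem S hmono fun i =>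
    ⟨i + 1, by rw [hS]; exact hsub _ (Finset.mem_insert_self _ _)⟩
  have hev := h (Function.extend φ A fun _ => ∅) (hA.extend hφ) ?_
    (Function.extend φ t fun _ => t 0) ?_
  · obtain ⟨K, hK⟩ := (hN.tendsto_atTop.eventually hev).exists
    refine (hSbad K).not_ge (le_of_eq_of_le ?_ hK)
    congr 2
    have himg : (S K).image φ ⊆ Finset.range (N K) := fun n hn => by
      obtain ⟨i, hi, rfl⟩ := Finset.mem_image.1 hn
      exact Finset.mem_range.2 ((hφN K i).2 hi)
    rw [← Finset.sum_subset himg, Finset.sum_image hφ.injOn]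
    · simp only [hφ.extend_apply]
    · intro n hn hn'
      rw [Function.extend_apply' A]
      · simp
      · rintro ⟨i, rfl⟩
        exact hn' (Finset.mem_image_of_mem _ ((hφN K i).1 (Finset.mem_range.1 hn)))
  · intro n
    by_cases hn : ∃ i, φ i = n
    · obtain ⟨i, rfl⟩ := hn
      exact ⟨i, by rw [hφ.extend_apply]⟩
    · exact ⟨0, by simp [Function.extend_apply' _ _ _ hn]⟩
  · intro n hne
    by_cases hn : ∃ i, φ i = n
    · obtain ⟨i, rfl⟩ := hn
      simp only [hφ.extend_apply] at hne ⊢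
      exact ht i hne
    · simp [Function.extend_apply' _ _ _ hn] at hne

/-! ### Oscillation over the members of a partition -/

theorem ApproxByRiemannSums.sum_abs_sub_le (h : ApproxByRiemannSums μ f v ε A)
    (hA : IsCountablePartition A) {t t' : ℕ → T} (ht : IsTagging t A) (ht' : IsTagging t' A)
    (y' : StrongDual ℝ Y) (S : Finset ℕ) :
    ∑ i ∈ S, μ.real (A i) * |y' (f (t' i)) - y' (f (t i))| ≤ 2 * ε * ‖y'‖ := by
  classical
  -- The two tags are exchanged wherever necessary to make every increment nonnegative. The sum of
  -- absolute values is then `y'` of a difference of two Riemann sums, each within `ε` of `v`.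
  let p : ℕ → Prop := fun i => y' (f (t i)) ≤ y' (f (t' i))
  let t₁ : ℕ → T := fun i => if p i then t' i else t i
  let t₂ : ℕ → T := fun i => if p i then t i else t' i
  have ht₁ : IsTagging t₁ A := fun i hi => by
    by_cases hp : p i <;> simp only [t₁, hp, if_true, if_false]
    exacts [ht' i hi, ht i hi]
  have ht₂ : IsTagging t₂ A := fun i hi => by
    by_cases hp : p i <;> simp only [t₂, hp, if_true, if_false]
    exacts [ht i hi, ht' i hi]
  have habs : ∀ i, |y' (f (t' i)) - y' (f (t i))| = y' (f (t₁ i)) - y' (f (t₂ i)) := fun i => by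
    by_cases hp : p i <;> simp only [t₁, t₂, hp, if_true, if_false]
    · exact abs_of_nonneg (sub_nonneg.2 hp)
    · rw [abs_of_nonpos (sub_nonpos.2 (not_le.1 hp).le), neg_sub]
  obtain ⟨n, hn₁, hn₂, hn⟩ := ((h A hA (.refl A) t₁ ht₁).and
    ((h A hA (.refl A) t₂ ht₂).and (eventually_gt_atTop (S.sup id)))).exists
  have hsub : S ⊆ Finset.range n := fun i hi =>
    Finset.mem_range.2 ((Finset.le_sup (f := id) hi).trans_lt hn)
  calc ∑ i ∈ S, μ.real (A i) * |y' (f (t' i)) - y' (f (t i))|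
      ≤ ∑ i ∈ Finset.range n, μ.real (A i) * |y' (f (t' i)) - y' (f (t i))| :=
        Finset.sum_le_sum_of_subset_of_nonneg hsub fun i _ _ => by positivity
    _ = y' ((∑ i ∈ Finset.range n, μ.real (A i) • f (t₁ i) - v)
          - (∑ i ∈ Finset.range n, μ.real (A i) • f (t₂ i) - v)) := by
        simp only [habs, map_sub, map_sum, map_smul, smul_eq_mul, mul_sub, Finset.sum_sub_distrib]
        ring
    _ ≤ ‖y'‖ * ‖(∑ i ∈ Finset.range n, μ.real (A i) • f (t₁ i) - v)
          - (∑ i ∈ Finset.range n, μ.real (A i) • f (t₂ i) - v)‖ :=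
        (le_abs_self _).trans (y'.le_opNorm _)
    _ ≤ ‖y'‖ * (ε + ε) := by
        gcongr
        exact (norm_sub_le _ _).trans (add_le_add hn₁ hn₂)
    _ = 2 * ε * ‖y'‖ := by ring

theorem IsCountablePartition.exists_index (hA : IsCountablePartition A) :
    ∃ idx : T → ℕ, Measurable idx ∧ ∀ i, idx ⁻¹' {i} = A i := by
  have hex : ∀ x, ∃ i, x ∈ A i := fun x => mem_iUnion.1 (hA.iUnion_eq ▸ mem_univ x)
  choose idx hidx using hex
  have hpre : ∀ i, idx ⁻¹' {i} = A i := fun i => by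
    ext x
    refine ⟨fun hx => (show idx x = i from hx) ▸ hidx x, fun hx => ?_⟩
    by_contra hc
    exact disjoint_left.1 (hA.pairwise_disjoint hc) (hidx x) hx
  exact ⟨idx, measurable_to_countable' fun i => hpre i ▸ hA.measurableSet i, hpre⟩

/-- If all sums of tagged increments of `g` over a partition are at most `c`, then the upper
integral of the oscillation of `g` over the members of the partition is at most `2 c`. -/
theorem exists_oscillation_bound {g : T → ℝ} (hfin : ∀ n, μ (A n) < ∞) {c : ℝ} {t : ℕ → T}
    (ht : IsTagging t A)
    (hosc : ∀ t', IsTagging t' A → ∀ S : Finset ℕ,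
      ∑ i ∈ S, μ.real (A i) * |g (t' i) - g (t i)| ≤ c) :
    ∃ o : ℕ → ℝ≥0∞, (∀ i, ∀ x ∈ A i, ‖g x - g (t i)‖ₑ ≤ o i) ∧
      ∑' i, o i * μ (A i) ≤ 2 * ENNReal.ofReal c := by
  classical
  let o : ℕ → ℝ≥0∞ := fun i => ⨆ x ∈ A i, ‖g x - g (t i)‖ₑ
  have hmul : ∀ i x, ‖g x - g (t i)‖ₑ * μ (A i) =
      ENNReal.ofReal (μ.real (A i) * |g x - g (t i)|) := fun i x => by
    rw [mul_comm, ENNReal.ofReal_mul measureReal_nonneg, Measure.real,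
      ENNReal.ofReal_toReal (hfin i).ne, ← Real.enorm_eq_ofReal_abs]
  have hsel : ∀ i, ∃ x, ((A i).Nonempty → x ∈ A i) ∧
      o i * μ (A i) ≤ 2 * (‖g x - g (t i)‖ₑ * μ (A i)) := by
    intro i
    -- On a null piece `o i` may be infinite, but the product vanishes.
    by_cases h0 : μ (A i) = 0
    · exact ⟨t i, ht i, by simp [h0]⟩
    have hne : (A i).Nonempty := nonempty_of_measure_ne_zero h0
    -- Retagging the single piece `i` already shows that `o i` is finite.
    have hbound : o i * μ (A i) ≤ ENNReal.ofReal c := by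
      simp only [o, ENNReal.iSup_mul]
      refine iSup₂_le fun x hx => ?_
      rw [hmul]
      refine ENNReal.ofReal_le_ofReal ?_
      have hup : IsTagging (Function.update t i x) A := fun m hm => by
        by_cases hmi : m = i
        · subst hmi
          simpa using hx
        · simpa [hmi] using ht m hm
      simpa using hosc _ hup {i}
    have hfin' : o i ≠ ∞ := fun hc => by
      rw [hc, ENNReal.top_mul h0] at hbound
      exact ENNReal.ofReal_ne_top (top_le_iff.1 hbound)
    by_cases ho : o i = 0
    · exact ⟨t i, ht i, by simp [ho]⟩
    -- The supremum need not be attained; a point reaching half of it costs the factor 2.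
    obtain ⟨x, hx⟩ := lt_iSup_iff.1 (ENNReal.half_lt_self ho hfin')
    obtain ⟨hxA, hx⟩ := lt_iSup_iff.1 hx
    refine ⟨x, fun _ => hxA, ?_⟩
    rw [← mul_assoc]
    gcongr
    rw [mul_comm]
    exact (ENNReal.div_le_iff_le_mul (by simp) (by simp)).1 hx.le
  choose t' ht' hle using hsel
  refine ⟨o, fun i x hx => le_iSup₂ (f := fun x (_ : x ∈ A i) => ‖g x - g (t i)‖ₑ) x hx, ?_⟩
  rw [ENNReal.tsum_eq_iSup_sum]
  refine iSup_le fun S => (Finset.sum_le_sum fun i _ => hle i).trans ?_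
  rw [← Finset.mul_sum]
  gcongr
  simp only [hmul]
  rw [← ENNReal.ofReal_sum_of_nonneg fun i _ => by positivity]
  exact ENNReal.ofReal_le_ofReal (hosc t' ht' S)

theorem IsCountablePartition.lintegral_comp_index {idx : T → ℕ} (hidx : Measurable idx)
    (hpre : ∀ i, idx ⁻¹' {i} = A i) (o : ℕ → ℝ≥0∞) :
    ∫⁻ x, o (idx x) ∂μ = ∑' i, o i * μ (A i) := by
  rw [← lintegral_map (f := o) (measurable_of_countable _) hidx, lintegral_countable']
  simp only [Measure.map_apply hidx (measurableSet_singleton _), hpre]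

end

/-! ### Pettis integrability of single-valued functions -/

section

variable {T Y : Type*} [MeasurableSpace T] [NormedAddCommGroup Y] [NormedSpace ℝ Y]
  {μ : Measure T} {f : T → Y} {v : Y} {ε : ℝ} {A : ℕ → Set T}

theorem exists_isTagging {T : Type*} [Nonempty T] (A : ℕ → Set T) :
    ∃ t : ℕ → T, IsTagging t A := by
  have : ∀ n, ∃ x, (A n).Nonempty → x ∈ A n := fun n => by
    by_cases h : (A n).Nonempty
    · exact ⟨h.some, fun _ => h.some_mem⟩
    · exact ⟨Classical.arbitrary T, fun h' => absurd h' h⟩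
  choose t ht using this
  exact ⟨t, ht⟩

theorem abs_sum_le_of_disjoint {S₀ S : Finset ℕ} {t : ℕ → T}
    (hS₀ : ∀ S, S₀ ⊆ S → ‖∑ i ∈ S, μ.real (A i) • f (t i) - v‖ ≤ ε) (y' : StrongDual ℝ Y)
    (hd : Disjoint S₀ S) : |∑ i ∈ S, μ.real (A i) * y' (f (t i))| ≤ 2 * ε * ‖y'‖ := by
  classical
  calc |∑ i ∈ S, μ.real (A i) * y' (f (t i))|
      = ‖y' ((∑ i ∈ S₀ ∪ S, μ.real (A i) • f (t i) - v)
          - (∑ i ∈ S₀, μ.real (A i) • f (t i) - v))‖ := by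
        rw [Finset.sum_union hd, Real.norm_eq_abs]
        simp only [map_add, map_sub, map_sum, map_smul, smul_eq_mul]
        ring_nf
    _ ≤ ‖y'‖ * ‖(∑ i ∈ S₀ ∪ S, μ.real (A i) • f (t i) - v)
          - (∑ i ∈ S₀, μ.real (A i) • f (t i) - v)‖ := y'.le_opNorm _
    _ ≤ ‖y'‖ * (ε + ε) := by
        gcongr
        exact (norm_sub_le _ _).trans
          (add_le_add (hS₀ _ Finset.subset_union_left) (hS₀ _ subset_rfl))
    _ = 2 * ε * ‖y'‖ := by ring

/-- Applying the bound to the nonnegative and the negative terms separately bounds the sums of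
absolute values off `S₀`. -/
theorem summable_of_abs_sum_le_of_disjoint {b : ℕ → ℝ} {S₀ : Finset ℕ} {c : ℝ}
    (h : ∀ S, Disjoint S₀ S → |∑ i ∈ S, b i| ≤ c) : Summable b := by
  classical
  have hsplit : ∀ S : Finset ℕ, Disjoint S₀ S → ∑ i ∈ S, |b i| ≤ c + c := by
    intro S hS
    rw [← Finset.sum_filter_add_sum_filter_not S (fun i => 0 ≤ b i)]
    refine add_le_add ?_ ?_
    · rw [Finset.sum_congr rfl fun i hi => abs_of_nonneg (Finset.mem_filter.1 hi).2]
      exact (le_abs_self _).trans (h _ (hS.mono_right (Finset.filter_subset _ _)))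
    · rw [Finset.sum_congr rfl fun i hi => abs_of_neg (not_le.1 (Finset.mem_filter.1 hi).2),
        Finset.sum_neg_distrib]
      exact (neg_le_abs _).trans (h _ (hS.mono_right (Finset.filter_subset _ _)))
  refine Summable.of_abs (summable_of_sum_le (c := ∑ i ∈ S₀, |b i| + (c + c))
    (fun i => abs_nonneg _) fun S => ?_)
  calc ∑ i ∈ S, |b i| ≤ ∑ i ∈ S₀ ∪ S, |b i| :=
        Finset.sum_le_sum_of_subset_of_nonneg Finset.subset_union_right fun _ _ _ => abs_nonneg _
    _ = ∑ i ∈ S₀, |b i| + ∑ i ∈ S \ S₀, |b i| := by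
        rw [← Finset.union_sdiff_self_eq_union, Finset.sum_union Finset.disjoint_sdiff]
    _ ≤ _ := by gcongr; exact hsplit _ Finset.disjoint_sdiff

theorem integrable_comp_index (hfin : ∀ n, μ (A n) < ∞) {idx : T → ℕ} (hidx : Measurable idx)
    (hpre : ∀ i, idx ⁻¹' {i} = A i) {a : ℕ → ℝ} (ha : Summable fun i => μ.real (A i) * a i) :
    Integrable (fun x => a (idx x)) μ := by
  refine ⟨((measurable_of_countable a).comp hidx).aestronglyMeasurable, ?_⟩
  rw [HasFiniteIntegral, IsCountablePartition.lintegral_comp_index hidx hpre fun i => ‖a i‖ₑ]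
  have : ∀ i, ‖a i‖ₑ * μ (A i) = ENNReal.ofReal |μ.real (A i) * a i| := fun i => by
    rw [abs_mul, abs_of_nonneg measureReal_nonneg, ENNReal.ofReal_mul measureReal_nonneg,
      Measure.real, ENNReal.ofReal_toReal (hfin i).ne, ← Real.enorm_eq_ofReal_abs, mul_comm]
  simp only [this]
  exact ha.abs.tsum_ofReal_lt_top

theorem hasSum_setIntegral_comp_index (hA : IsCountablePartition A)
    {idx : T → ℕ} (hpre : ∀ i, idx ⁻¹' {i} = A i) {a : ℕ → ℝ}
    (hint : Integrable (fun x => a (idx x)) μ) {E : Set T}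
    (hAE : ∀ i, A i ⊆ E ∨ A i ⊆ Eᶜ) :
    HasSum ({i | A i ⊆ E}.indicator fun i => μ.real (A i) * a i) (∫ x in E, a (idx x) ∂μ) := by
  classical
  let B : ℕ → Set T := fun i => if A i ⊆ E then A i else ∅
  have hB : ∀ i, B i ⊆ A i := fun i => by
    by_cases h : A i ⊆ E <;> simp [B, h]
  have hBU : ⋃ i, B i = E := by
    ext x
    refine ⟨fun hx => ?_, fun hx => ?_⟩
    · obtain ⟨i, hi⟩ := mem_iUnion.1 hx
      by_cases h : A i ⊆ E
      · exact h (hB i hi)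
      · simp [B, h] at hi
    · obtain ⟨i, hi⟩ := mem_iUnion.1 (hA.iUnion_eq ▸ mem_univ x)
      have h : A i ⊆ E := (hAE i).resolve_right fun hc => hc hi hx
      exact mem_iUnion.2 ⟨i, by simpa [B, h] using hi⟩
  have key := hasSum_integral_iUnion (μ := μ) (f := fun x => a (idx x)) (s := B)
    (fun i => by
      by_cases h : A i ⊆ E
      · simpa [B, h] using hA.measurableSet i
      · simp [B, h])
    (fun i j hij => (hA.pairwise_disjoint hij).mono (hB i) (hB j)) hint.integrableOn
  rw [hBU] at key
  suffices heq : ({i | A i ⊆ E}.indicator fun i => μ.real (A i) * a i) =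
      fun i => ∫ x in B i, a (idx x) ∂μ by
    rw [heq]
    exact key
  funext i
  by_cases h : A i ⊆ E
  · rw [indicator_of_mem (show i ∈ {i | A i ⊆ E} from h)]
    simp only [B, h, if_true]
    rw [setIntegral_congr_fun (g := fun _ => a i) (hA.measurableSet i) fun x hx => ?_,
      setIntegral_const, smul_eq_mul]
    have : idx x = i := by rwa [← hpre] at hx
    simp [this]
  · rw [indicator_of_notMem (show i ∉ {i | A i ⊆ E} from h)]
    simp [B, h]

/-- The measurable majorant `H` is needed because `y' ∘ f` is not yet known to be measurable. -/
theorem ApproxByRiemannSums.exists_lintegral_bound (h : ApproxByRiemannSums μ f v ε A)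
    (hA : IsCountablePartition A) (hfin : ∀ n, μ (A n) < ∞) {t : ℕ → T} (ht : IsTagging t A)
    {idx : T → ℕ} (hidx : Measurable idx) (hpre : ∀ i, idx ⁻¹' {i} = A i)
    (y' : StrongDual ℝ Y) :
    ∃ H : T → ℝ≥0∞, Measurable H ∧ (∀ x, ‖y' (f x) - y' (f (t (idx x)))‖ₑ ≤ H x) ∧
      ∫⁻ x, H x ∂μ ≤ 2 * ENNReal.ofReal (2 * ε * ‖y'‖) := by
  obtain ⟨o, ho, hsum⟩ := exists_oscillation_bound (g := fun x => y' (f x)) hfin ht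
    fun t' ht' S => h.sum_abs_sub_le hA ht ht' y' S
  refine ⟨fun x => o (idx x), (measurable_of_countable o).comp hidx, fun x => ?_, ?_⟩
  · exact ho (idx x) x (by rw [← hpre]; rfl)
  · rwa [IsCountablePartition.lintegral_comp_index hidx hpre]

/-- The single-valued simple-Birkhoff integral, with norm estimates. -/
def HasSimpleBirkhoffIntegral (μ : Measure T) (f : T → Y) (v : Y) : Prop :=
  ∀ ε : ℝ, 0 < ε → ∃ A : ℕ → Set T, IsCountablePartition A ∧ (∀ n, μ (A n) < ∞) ∧
    ApproxByRiemannSums μ f v ε A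

theorem HasSimpleBirkhoffIntegral.integrable [Nonempty T] (hf : HasSimpleBirkhoffIntegral μ f v)
    (y' : StrongDual ℝ Y) : Integrable (fun x => y' (f x)) μ := by
  have hstep : ∀ k : ℕ, ∃ u : T → ℝ, Measurable u ∧ Integrable u μ ∧ ∃ H : T → ℝ≥0∞,
      Measurable H ∧ (∀ x, ‖y' (f x) - u x‖ₑ ≤ H x) ∧
      ∫⁻ x, H x ∂μ ≤ 2 * ENNReal.ofReal (2 * (1 / 2) ^ k * ‖y'‖) := by
    intro k
    obtain ⟨A, hA, hfin, h⟩ := hf ((1 / 2) ^ k) (by positivity)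
    obtain ⟨t, ht⟩ := exists_isTagging A
    obtain ⟨idx, hidx, hpre⟩ := hA.exists_index
    obtain ⟨S₀, hS₀⟩ := h.exists_finset hA ht
    have hsum := summable_of_abs_sum_le_of_disjoint fun S hS => abs_sum_le_of_disjoint hS₀ y' hS
    exact ⟨fun x => y' (f (t (idx x))),
      (measurable_of_countable fun i => y' (f (t i))).comp hidx,
      integrable_comp_index hfin hidx hpre hsum, h.exists_lintegral_bound hA hfin ht hidx hpre y'⟩
  choose u hu hui H hH hle hint using hstep
  have hmeas : AEStronglyMeasurable (fun x => y' (f x)) μ := by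
    -- The geometric choice of errors makes the majorants summable in L¹. Hence `H k → 0` almost
    -- everywhere and `y' ∘ f` is an a.e. limit of measurable functions.
    have htsum : ∫⁻ x, ∑' k, H k x ∂μ ≠ ∞ := by
      rw [lintegral_tsum fun k => (hH k).aemeasurable]
      refine ne_top_of_le_ne_top ?_ (ENNReal.tsum_le_tsum hint)
      rw [ENNReal.tsum_mul_left]
      refine ENNReal.mul_ne_top (by simp) (Summable.tsum_ofReal_ne_top ?_)
      exact (summable_geometric_two.mul_left 2).mul_right _
    have hae := ae_lt_top (Measurable.tsum hH) htsum
    refine aestronglyMeasurable_of_tendsto_ae atTop (fun k => (hu k).aestronglyMeasurable) ?_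
    filter_upwards [hae] with x hx
    rw [tendsto_iff_edist_tendsto_0]
    refine tendsto_of_tendsto_of_tendsto_of_le_of_le tendsto_const_nhds
      (ENNReal.tendsto_atTop_zero_of_tsum_ne_top hx.ne) (fun _ => zero_le) fun k => ?_
    rw [edist_comm, edist_eq_enorm_sub]
    exact hle k x
  have hdiff : Integrable (fun x => y' (f x) - u 0 x) μ := by
    refine ⟨hmeas.sub (hu 0).aestronglyMeasurable, ?_⟩
    refine (lintegral_mono (hle 0)).trans_lt ((hint 0).trans_lt ?_)
    exact ENNReal.mul_lt_top (by simp) ENNReal.ofReal_lt_top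
  exact (hdiff.add (hui 0)).congr (Eventually.of_forall fun x => sub_add_cancel _ _)

theorem exists_isCountablePartition_split (hA : IsCountablePartition A) {E : Set T}
    (hE : MeasurableSet E) :
    ∃ B : ℕ → Set T, IsCountablePartition B ∧ IsFinerThan B A ∧ ∀ i, B i ⊆ E ∨ B i ⊆ Eᶜ := by
  let s : Bool → Set T := fun b => cond b E Eᶜ
  have hs : ∀ b, MeasurableSet (s b) := fun b => by cases b; exacts [hE.compl, hE]
  let e : ℕ ≃ Bool × ℕ := Equiv.boolProdNatEquivNat.symm
  refine ⟨fun n => s (e n).1 ∩ A (e n).2, ⟨fun n => (hs _).inter (hA.measurableSet _), ?_, ?_⟩,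
    fun n => ⟨(e n).2, inter_subset_right⟩, fun n => ?_⟩
  · intro m n hmn
    by_cases h2 : (e m).2 = (e n).2
    · have h1 : (e m).1 ≠ (e n).1 := fun h1 => hmn (e.injective (Prod.ext h1 h2))
      have : Disjoint (s (e m).1) (s (e n).1) := by
        revert h1
        cases (e m).1 <;> cases (e n).1 <;> simp [s, disjoint_compl_left, disjoint_compl_right]
      exact this.mono inter_subset_left inter_subset_left
    · exact (hA.pairwise_disjoint h2).mono inter_subset_right inter_subset_right
  · rw [eq_univ_iff_forall]
    intro x
    obtain ⟨i, hi⟩ := mem_iUnion.1 (hA.iUnion_eq ▸ mem_univ x)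
    by_cases hx : x ∈ E
    · exact mem_iUnion.2 ⟨e.symm (true, i), by simp [s, hx, hi]⟩
    · exact mem_iUnion.2 ⟨e.symm (false, i), by simp [s, hx, hi]⟩
  · cases h : (e n).1
    · exact Or.inr (by simp [h, s])
    · exact Or.inl (by simp [h, s])

/-- The integrals over `E` of all `y' ∘ f` are approximated by a single finite combination of
values of `f` with nonnegative coefficients. -/
theorem HasSimpleBirkhoffIntegral.exists_approx [Nonempty T]
    (hf : HasSimpleBirkhoffIntegral μ f v) {E : Set T} (hE : MeasurableSet E) (hε : 0 < ε) :
    ∃ (S : Finset ℕ) (c : ℕ → ℝ) (t : ℕ → T), (∀ i, 0 ≤ c i) ∧ ∀ y' : StrongDual ℝ Y,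
      |y' (∑ i ∈ S, c i • f (t i)) - ∫ x in E, y' (f x) ∂μ| ≤ ε * ‖y'‖ := by
  classical
  -- The tail of the sum costs `2 * (ε / 6)` and the oscillation `4 * (ε / 6)`, both times `‖y'‖`.
  obtain ⟨A₀, hA₀, hfin₀, h₀⟩ := hf (ε / 6) (by positivity)
  obtain ⟨A, hA, hAA₀, hAE⟩ := exists_isCountablePartition_split hA₀ hE
  have h := h₀.of_isFinerThan hAA₀
  have hfin : ∀ n, μ (A n) < ∞ := fun n => by
    obtain ⟨m, hm⟩ := hAA₀ n
    exact (measure_mono hm).trans_lt (hfin₀ m)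
  obtain ⟨t, ht⟩ := exists_isTagging A
  obtain ⟨idx, hidx, hpre⟩ := hA.exists_index
  obtain ⟨S₀, hS₀⟩ := h.exists_finset hA ht
  let J : Set ℕ := {i | A i ⊆ E}
  refine ⟨S₀.filter (· ∈ J), fun i => μ.real (A i), t, fun i => measureReal_nonneg, fun y' => ?_⟩
  set w : Y := ∑ i ∈ S₀.filter (· ∈ J), μ.real (A i) • f (t i) with hw
  let u : T → ℝ := fun x => y' (f (t (idx x)))
  have hui : Integrable u μ := integrable_comp_index hfin hidx hpre (a := fun i => y' (f (t i)))
    (summable_of_abs_sum_le_of_disjoint fun S hS => abs_sum_le_of_disjoint hS₀ y' hS)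
  have hsum := hasSum_setIntegral_comp_index hA hpre (a := fun i => y' (f (t i))) hui hAE
  have h₁ : |(∫ x in E, u x ∂μ) - y' w| ≤ 2 * (ε / 6) * ‖y'‖ := by
    refine le_of_tendsto ((hsum.sub_const (y' w)).abs) ?_
    filter_upwards [eventually_ge_atTop S₀] with S hS
    have : ∑ i ∈ S, J.indicator (fun i => μ.real (A i) * y' (f (t i))) i - y' w
        = ∑ i ∈ (S \ S₀).filter (· ∈ J), μ.real (A i) * y' (f (t i)) := by
      rw [hw, ← Finset.sum_sdiff hS]
      simp only [map_sum, Finset.sum_filter, indicator_apply, apply_ite y', map_zero, map_smul,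
        smul_eq_mul]
      ring
    rw [this]
    exact abs_sum_le_of_disjoint hS₀ y'
      (Finset.disjoint_sdiff.mono_right (Finset.filter_subset _ _))
  have h₂ : |(∫ x in E, y' (f x) ∂μ) - ∫ x in E, u x ∂μ| ≤ 4 * (ε / 6) * ‖y'‖ := by
    obtain ⟨H, -, hle, hint⟩ := h.exists_lintegral_bound hA hfin ht hidx hpre y'
    rw [← integral_sub (hf.integrable y').integrableOn hui.integrableOn]
    have : ‖∫ x in E, (y' (f x) - u x) ∂μ‖ₑ ≤ ENNReal.ofReal (4 * (ε / 6) * ‖y'‖) :=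
      calc ‖∫ x in E, (y' (f x) - u x) ∂μ‖ₑ ≤ ∫⁻ x in E, ‖y' (f x) - u x‖ₑ ∂μ :=
            enorm_integral_le_lintegral_enorm _
        _ ≤ ∫⁻ x, H x ∂μ := (setLIntegral_le_lintegral _ _).trans (lintegral_mono hle)
        _ ≤ 2 * ENNReal.ofReal (2 * (ε / 6) * ‖y'‖) := hint
        _ = ENNReal.ofReal (4 * (ε / 6) * ‖y'‖) := by
            rw [show (2 : ℝ≥0∞) = ENNReal.ofReal 2 by simp, ← ENNReal.ofReal_mul (by norm_num)]
            ring_nf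
    rwa [Real.enorm_eq_ofReal_abs, ENNReal.ofReal_le_ofReal_iff (by positivity)] at this
  rw [abs_le] at *
  constructor <;> nlinarith

/-- The estimate is uniform on the dual unit ball, which norms `Y`, so the approximants form a
Cauchy sequence. -/
theorem exists_forall_dual_eq [CompleteSpace Y] {Λ : StrongDual ℝ Y → ℝ}
    (h : ∀ ε : ℝ, 0 < ε → ∃ w : Y, ∀ y' : StrongDual ℝ Y, |y' w - Λ y'| ≤ ε * ‖y'‖) :
    ∃ y : Y, ∀ y' : StrongDual ℝ Y, y' y = Λ y' := by
  choose! w hw using h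
  let ε : ℕ → ℝ := fun n => 1 / (n + 1)
  have hε : ∀ n, 0 < ε n := fun n => Nat.one_div_pos_of_nat
  have hε0 : Tendsto ε atTop (nhds 0) := tendsto_one_div_add_atTop_nhds_zero_nat
  have hdist : ∀ n m, dist (w (ε n)) (w (ε m)) ≤ ε n + ε m := fun n m => by
    rw [dist_eq_norm]
    refine NormedSpace.norm_le_dual_bound ℝ _ (add_pos (hε n) (hε m)).le fun y' => ?_
    rw [map_sub, Real.norm_eq_abs]
    have h₁ := abs_le.1 (hw _ (hε n) y')
    have h₂ := abs_le.1 (hw _ (hε m) y')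
    rw [abs_le]
    constructor <;> linarith
  have hcau : CauchySeq fun n => w (ε n) := by
    refine cauchySeq_of_le_tendsto_0 (fun n => 2 * ε n) (fun n m N hn hm => ?_) ?_
    · have h₁ : ε n ≤ ε N := Nat.one_div_le_one_div hn
      have h₂ : ε m ≤ ε N := Nat.one_div_le_one_div hm
      linarith [hdist n m]
    · simpa using hε0.const_mul 2
  obtain ⟨y, hy⟩ := cauchySeq_tendsto_of_complete hcau
  refine ⟨y, fun y' => tendsto_nhds_unique ((y'.continuous.tendsto y).comp hy) ?_⟩
  rw [tendsto_iff_dist_tendsto_zero]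
  refine squeeze_zero (fun _ => dist_nonneg) (fun n => hw _ (hε n) y') ?_
  simpa using hε0.mul_const ‖y'‖

theorem HasSimpleBirkhoffIntegral.isPettisIntegrable [Nonempty T] [CompleteSpace Y]
    (hf : HasSimpleBirkhoffIntegral μ f v) : IsPettisIntegrable μ f :=
  ⟨hf.integrable, fun _ hE => exists_forall_dual_eq fun _ hε => by
    obtain ⟨S, c, t, -, h⟩ := hf.exists_approx hE hε
    exact ⟨_, h⟩⟩

end

/-! ### Support functions and the algebra of `cwk(X)` -/

section

variable {X : Type*} [NormedAddCommGroup X] [NormedSpace ℝ X]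

theorem Cwk.isBounded (C : Cwk X) : Bornology.IsBounded C.1 :=
  isBounded_iff_forall_norm_le.2 C.exists_norm_le

theorem Cwk.bddAbove_image (C : Cwk X) (x' : StrongDual ℝ X) :
    BddAbove ((fun x => x' x) '' C.1) := by
  obtain ⟨M, hM⟩ := C.exists_norm_le
  refine ⟨‖x'‖ * M, ?_⟩
  rintro _ ⟨x, hx, rfl⟩
  exact (le_abs_self _).trans ((x'.le_opNorm x).trans (by gcongr; exact hM x hx))

theorem Cwk.le_supportFun (C : Cwk X) (x' : StrongDual ℝ X) {x : X} (hx : x ∈ C.1) :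
    x' x ≤ supportFun x' C.1 :=
  le_csSup (C.bddAbove_image x') (mem_image_of_mem _ hx)

theorem Cwk.supportFun_le (C : Cwk X) {x' : StrongDual ℝ X} {r : ℝ}
    (h : ∀ x ∈ C.1, x' x ≤ r) : supportFun x' C.1 ≤ r :=
  csSup_le (C.2.1.image _) (forall_mem_image.2 h)

theorem Cwk.supportFun_add_le (C : Cwk X) (x' y' : StrongDual ℝ X) :
    supportFun (x' + y') C.1 ≤ supportFun x' C.1 + supportFun y' C.1 :=
  C.supportFun_le fun _ hx => add_le_add (C.le_supportFun x' hx) (C.le_supportFun y' hx)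

theorem supportFun_smul {c : ℝ} (hc : 0 ≤ c) (x' : StrongDual ℝ X) (C : Set X) :
    supportFun (c • x') C = c * supportFun x' C := by
  rw [supportFun, supportFun, ← smul_eq_mul, ← Real.sSup_smul_of_nonneg hc, ← image_smul,
    image_image]
  rfl

theorem Cwk.supportFun_combination {α β : ℝ} (hα : 0 ≤ α) (hβ : 0 ≤ β) {A C D : Cwk X}
    (hD : D.1 = α • A.1 + β • C.1) (x' : StrongDual ℝ X) :
    supportFun x' D.1 = α * supportFun x' A.1 + β * supportFun x' C.1 := by
  have h : ∀ (γ : ℝ) (E : Set X), (fun x => x' x) '' (γ • E) = γ • ((fun x => x' x) '' E) :=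
    fun γ E => by simp only [← image_smul, image_image, map_smul]
  have himg : (fun x => x' x) '' D.1 =
      α • ((fun x => x' x) '' A.1) + β • ((fun x => x' x) '' C.1) := by
    rw [hD, ← h, ← h]
    exact image_add x'
  rw [supportFun, himg, csSup_add ((A.2.1.image _).smul_set) ((A.bddAbove_image x').smul_of_nonneg hα)
    ((C.2.1.image _).smul_set) ((C.bddAbove_image x').smul_of_nonneg hβ),
    Real.sSup_smul_of_nonneg hα, Real.sSup_smul_of_nonneg hβ]
  rfl

theorem Cwk.hausdorffEDist_ne_top (A C : Cwk X) : Metric.hausdorffEDist A.1 C.1 ≠ ∞ :=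
  Metric.hausdorffEDist_ne_top_of_nonempty_of_bounded A.2.1 C.2.1 A.isBounded C.isBounded

theorem Cwk.supportFun_le_add_hausdorffDist (A C : Cwk X) {x' : StrongDual ℝ X}
    (hx' : ‖x'‖ ≤ 1) :
    supportFun x' A.1 ≤ supportFun x' C.1 + Metric.hausdorffDist A.1 C.1 := by
  refine A.supportFun_le fun x hx => le_of_forall_pos_le_add fun δ hδ => ?_
  obtain ⟨y, hy, hxy⟩ := Metric.exists_dist_lt_of_hausdorffDist_lt hx
    (lt_add_of_pos_right (Metric.hausdorffDist A.1 C.1) hδ) (A.hausdorffEDist_ne_top C)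
  have h₁ := C.le_supportFun x' hy
  have h₂ : x' x - x' y ≤ dist x y := by
    rw [← map_sub, dist_eq_norm]
    exact (le_abs_self _).trans ((x'.le_opNorm _).trans (mul_le_of_le_one_left (norm_nonneg _) hx'))
  linarith

theorem norm_radstromEmbedding_sub_le (A C : Cwk X) :
    ‖radstromEmbedding A - radstromEmbedding C‖ ≤ Metric.hausdorffDist A.1 C.1 := by
  refine lp.norm_le_of_forall_le Metric.hausdorffDist_nonneg fun x' => ?_
  have hx' : ‖x'.1‖ ≤ 1 := mem_closedBall_zero_iff.1 x'.2
  have h₁ := A.supportFun_le_add_hausdorffDist C hx'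
  have h₂ := C.supportFun_le_add_hausdorffDist A hx'
  rw [Metric.hausdorffDist_comm] at h₂
  change |supportFun x'.1 A.1 - supportFun x'.1 C.1| ≤ _
  rw [abs_le]
  constructor <;> linarith

theorem radstromEmbedding_combination {α β : ℝ} (hα : 0 ≤ α) (hβ : 0 ≤ β) {A C D : Cwk X}
    (hD : D.1 = α • A.1 + β • C.1) :
    radstromEmbedding D = α • radstromEmbedding A + β • radstromEmbedding C :=
  lp.ext (funext fun x' => Cwk.supportFun_combination hα hβ hD x'.1)

theorem Cwk.exists_combination (α β : ℝ) (A C : Cwk X) :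
    ∃ D : Cwk X, D.1 = α • A.1 + β • C.1 := by
  refine ⟨⟨α • A.1 + β • C.1, A.2.1.smul_set.add C.2.1.smul_set,
    (A.2.2.1.smul α).add (C.2.2.1.smul β), ?_⟩, rfl⟩
  have : toWeakSpace ℝ X '' (α • A.1 + β • C.1) =
      α • (toWeakSpace ℝ X '' A.1) + β • (toWeakSpace ℝ X '' C.1) := by
    simp only [← image_smul, image_image, ← map_smul]
    rw [image_add, image_image, image_image]
  rw [this]
  exact (A.2.2.2.smul α).add (C.2.2.2.smul β)

theorem Cwk.exists_zero : ∃ D : Cwk X, D.1 = 0 :=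
  ⟨⟨0, zero_nonempty, convex_singleton 0, by
    rw [← singleton_zero, image_singleton]; exact isCompact_singleton⟩, rfl⟩

/-- A map on `cwk(X)` which respects nonnegative combinations respects finite sums. -/
theorem Cwk.exists_sum {Y : Type*} [AddCommGroup Y] [Module ℝ Y] {j : Cwk X → Y}
    (hj : ∀ α β : ℝ, 0 ≤ α → 0 ≤ β → ∀ A C D : Cwk X,
      D.1 = α • A.1 + β • C.1 → j D = α • j A + β • j C)
    {ι : Type*} (S : Finset ι) {c : ι → ℝ} (hc : ∀ i, 0 ≤ c i) (G : ι → Cwk X) :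
    ∃ D : Cwk X, D.1 = ∑ i ∈ S, c i • (G i).1 ∧ j D = ∑ i ∈ S, c i • j (G i) := by
  classical
  induction S using Finset.induction_on with
  | empty =>
    obtain ⟨D, hD⟩ := Cwk.exists_zero (X := X)
    refine ⟨D, hD, ?_⟩
    -- Zero coefficients force `j {0} = 0`.
    have := hj 0 0 le_rfl le_rfl D D D (by rw [zero_smul_set D.2.1, add_zero, hD])
    simpa using this
  | insert i S hi ih =>
    obtain ⟨D, hD, hjD⟩ := ih
    obtain ⟨D', hD'⟩ := Cwk.exists_combination (c i) 1 (G i) D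
    refine ⟨D', ?_, ?_⟩
    · rw [hD', Finset.sum_insert hi, one_smul, hD]
    · rw [hj _ _ (hc i) zero_le_one _ _ _ hD', Finset.sum_insert hi, one_smul, hjD]

/-! ### Weak* separation and completeness of `cwk(X)` -/

theorem WeakDual.exists_lt_of_notMem {E : Type*} [NormedAddCommGroup E] [NormedSpace ℝ E]
    {K : Set (WeakDual ℝ E)} (hK : Convex ℝ K) (hKc : IsClosed K) {φ : WeakDual ℝ E}
    (hφ : φ ∉ K) : ∃ (x : E) (u : ℝ), (∀ ψ ∈ K, ψ x < u) ∧ u < φ x := by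
  have : LocallyConvexSpace ℝ (WeakDual ℝ E) :=
    (WeakDual.withSeminorms (𝕜 := ℝ) (E := E)).toLocallyConvexSpace
  obtain ⟨f, u, hfu, huφ⟩ := geometric_hahn_banach_closed_point hK hKc hφ
  -- Weak* continuous functionals on the dual are evaluations at points.
  obtain ⟨x, rfl⟩ := LinearMap.dualEmbedding_surjective (topDualPairing ℝ E) f
  exact ⟨x, u, hfu, huφ⟩

theorem LinearIsometry.exists_apply_eq_of_approx {Z : Type*} [CompleteSpace X]
    [NormedAddCommGroup Z] [NormedSpace ℝ Z] (J : X →ₗᵢ[ℝ] Z) {z : Z}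
    (h : ∀ δ : ℝ, 0 < δ → ∃ x, ‖z - J x‖ ≤ δ) : ∃ x, J x = z := by
  refine J.isometry.isClosedEmbedding.isClosed_range.closure_subset
    (Metric.mem_closure_iff.2 fun δ hδ => ?_)
  obtain ⟨x, hx⟩ := h (δ / 2) (half_pos hδ)
  refine ⟨_, ⟨x, rfl⟩, ?_⟩
  rw [dist_eq_norm]
  exact hx.trans_lt (half_lt_self hδ)

theorem WeakDual.exists_norm_sub_le {E : Type*} [NormedAddCommGroup E] [NormedSpace ℝ E]
    {K : Set (WeakDual ℝ E)} (hK : Convex ℝ K) (hKc : IsCompact K) {ε : ℝ} (hε : 0 ≤ ε)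
    {φ : StrongDual ℝ E} (hφ : ∀ x r, (∀ ψ ∈ K, ψ x ≤ r) → φ x ≤ r + ε * ‖x‖) :
    ∃ ψ ∈ K, ‖φ - WeakDual.toStrongDual ψ‖ ≤ ε := by
  let B : Set (WeakDual ℝ E) :=
    WeakDual.toStrongDual ⁻¹' Metric.closedBall (0 : StrongDual ℝ E) ε
  have hB : IsCompact B := WeakDual.isCompact_closedBall 0 ε
  have hBc : Convex ℝ B := fun φ hφ ψ hψ a b ha hb hab =>
    convex_closedBall (0 : StrongDual ℝ E) ε hφ hψ ha hb hab
  -- `K + B` is weak* compact and convex. If `φ` lay outside, a separating `x` would contradict the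
  -- domination, since evaluation at `x` attains `ε * ‖x‖` on `B` at `ε` times a norming functional.
  by_cases hmem : StrongDual.toWeakDual φ ∈ K + B
  · obtain ⟨ψ, hψ, χ, hχ, hsum⟩ := hmem
    refine ⟨ψ, hψ, ?_⟩
    have h : φ - WeakDual.toStrongDual ψ = WeakDual.toStrongDual χ :=
      sub_eq_iff_eq_add'.2 (Eq.symm hsum)
    rw [h]
    exact (mem_closedBall_zero_iff (a := WeakDual.toStrongDual χ)).1 hχ
  · exfalso
    obtain ⟨x, u, hu, huφ⟩ :=
      WeakDual.exists_lt_of_notMem (hK.add hBc) (hKc.add hB).isClosed hmem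
    obtain ⟨g, hg, hgx⟩ := exists_dual_vector'' ℝ x
    have hgB : StrongDual.toWeakDual (ε • g) ∈ B := by
      refine (mem_closedBall_zero_iff (a := ε • g)).2 ?_
      rw [norm_smul, Real.norm_of_nonneg hε]
      exact mul_le_of_le_one_right hε hg
    have h := hφ x (u - ε * ‖x‖) fun ψ hψ => by
      have h : ψ x + ε * g x < u := hu _ (add_mem_add hψ hgB)
      rw [hgx] at h
      simp only [RCLike.ofReal_real_eq_id, id] at h
      linarith
    have h' : u < φ x := huφ
    linarith

/-- An element of the bidual dominated by `s(·, C) + ε ‖·‖` is within `ε` of an element of `C`. -/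
theorem Cwk.exists_norm_sub_inclusionInDoubleDual_le (C : Cwk X) {ε : ℝ} (hε : 0 ≤ ε)
    {φ : StrongDual ℝ (StrongDual ℝ X)}
    (hφ : ∀ x', φ x' ≤ supportFun x' C.1 + ε * ‖x'‖) :
    ∃ x ∈ C.1, ‖φ - NormedSpace.inclusionInDoubleDual ℝ X x‖ ≤ ε := by
  let J := NormedSpace.inclusionInDoubleDualWeak ℝ X
  obtain ⟨_, ⟨_, ⟨x, hx, rfl⟩, rfl⟩, h⟩ := WeakDual.exists_norm_sub_le
    (K := J '' (toWeakSpace ℝ X '' C.1))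
    ((C.2.2.1.linear_image (toWeakSpace ℝ X).toLinearMap).linear_image J.toLinearMap)
    (C.2.2.2.image J.continuous) hε (φ := φ) fun x' r hr => by
      have : supportFun x' C.1 ≤ r := C.supportFun_le fun x hx =>
        hr _ (mem_image_of_mem J (mem_image_of_mem (toWeakSpace ℝ X) hx))
      linarith [hφ x']
  exact ⟨x, hx, h⟩

/-- `cwk(X)` is complete, in terms of support functions. -/
theorem Cwk.exists_supportFun_eq [CompleteSpace X] {p : StrongDual ℝ X → ℝ}
    (hp : ∀ ε : ℝ, 0 < ε → ∃ C : Cwk X, ∀ x', |supportFun x' C.1 - p x'| ≤ ε * ‖x'‖) :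
    ∃ C : Cwk X, ∀ x', supportFun x' C.1 = p x' := by
  have hp_smul : ∀ c : ℝ, 0 ≤ c → ∀ x', p (c • x') = c * p x' := by
    intro c hc x'
    refine eq_of_forall_dist_le fun δ hδ => ?_
    obtain ⟨C, hC⟩ := hp (δ / (2 * c * ‖x'‖ + 1)) (by positivity)
    have h₁ := abs_le.1 (hC (c • x'))
    have h₂ := abs_le.1 (hC x')
    rw [supportFun_smul hc, norm_smul, Real.norm_of_nonneg hc] at h₁
    have h₃ : δ / (2 * c * ‖x'‖ + 1) * (2 * c * ‖x'‖) ≤ δ := by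
      rw [div_mul_eq_mul_div, div_le_iff₀ (by positivity)]
      nlinarith
    have h₄ := mul_le_mul_of_nonneg_left h₂.1 hc
    have h₅ := mul_le_mul_of_nonneg_left h₂.2 hc
    rw [Real.dist_eq, abs_le]
    constructor <;> nlinarith
  have hp_add : ∀ x' y', p (x' + y') ≤ p x' + p y' := by
    intro x' y'
    refine le_of_forall_pos_le_add fun δ hδ => ?_
    let N : ℝ := ‖x' + y'‖ + ‖x'‖ + ‖y'‖
    have hN : 0 ≤ N := by positivity
    obtain ⟨C, hC⟩ := hp (δ / (N + 1)) (by positivity)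
    have h₁ := abs_le.1 (hC (x' + y'))
    have h₂ := abs_le.1 (hC x')
    have h₃ := abs_le.1 (hC y')
    have h₄ := C.supportFun_add_le x' y'
    have h₅ : δ / (N + 1) * ‖x' + y'‖ + δ / (N + 1) * ‖x'‖ + δ / (N + 1) * ‖y'‖ ≤ δ := by
      rw [← mul_add, ← mul_add, div_mul_eq_mul_div, div_le_iff₀ (by positivity)]
      change δ * N ≤ δ * (N + 1)
      nlinarith
    linarith
  have hp_zero : p 0 = 0 := by simpa using hp_smul 0 le_rfl 0
  obtain ⟨R, hR, hpR⟩ : ∃ R : ℝ, 0 ≤ R ∧ ∀ x', p x' ≤ R * ‖x'‖ := by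
    obtain ⟨C, hC⟩ := hp 1 one_pos
    obtain ⟨M, hM⟩ := C.exists_norm_le
    have hM0 : 0 ≤ M := (norm_nonneg _).trans (hM _ C.2.1.some_mem)
    refine ⟨M + 1, by positivity, fun x' => ?_⟩
    have h₁ : supportFun x' C.1 ≤ M * ‖x'‖ := C.supportFun_le fun x hx =>
      (le_abs_self _).trans ((x'.le_opNorm x).trans (by rw [mul_comm]; gcongr; exact hM x hx))
    have h₂ := abs_le.1 (hC x')
    linarith
  let J := NormedSpace.inclusionInDoubleDualWeak ℝ X
  -- The candidate set is first built in the bidual, where it is weak* compact by Banach–Alaoglu.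
  let K : Set (WeakDual ℝ (StrongDual ℝ X)) := {φ | ∀ x', φ x' ≤ p x'}
  have habs : ∀ φ : StrongDual ℝ X →ₗ[ℝ] ℝ, (∀ x', φ x' ≤ p x') → ∀ x', ‖φ x'‖ ≤ R * ‖x'‖ := by
    intro φ hφ x'
    rw [Real.norm_eq_abs, abs_le]
    have h₁ := (hφ (-x')).trans (hpR (-x'))
    rw [map_neg, norm_neg] at h₁
    exact ⟨by linarith, (hφ x').trans (hpR x')⟩
  have hKc : IsCompact K := by
    refine (WeakDual.isCompact_closedBall (𝕜 := ℝ) (E := StrongDual ℝ X) 0 R).of_isClosed_subset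
      ?_ fun φ hφ => ?_
    · have : K = ⋂ x', {φ : WeakDual ℝ (StrongDual ℝ X) | φ x' ≤ p x'} := by
        ext φ; simp [K]
      rw [this]
      exact isClosed_iInter fun x' => isClosed_le (WeakDual.eval_continuous x') continuous_const
    · refine mem_closedBall_zero_iff.2 ?_
      exact ContinuousLinearMap.opNorm_le_bound _ hR
        (habs (WeakDual.toStrongDual φ).toLinearMap hφ)
  -- Each element of `K` is within every `δ` of the canonical image of `X`, which is norm closed
  -- because `X` is complete. So `K` consists of points of `X`, and its weak* compactness becomes
  -- weak compactness.
  have hKrange : ∀ φ : StrongDual ℝ (StrongDual ℝ X), (∀ x', φ x' ≤ p x') →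
      ∃ x, NormedSpace.inclusionInDoubleDual ℝ X x = φ := by
    intro φ hφ
    refine LinearIsometry.exists_apply_eq_of_approx
      (Z := StrongDual ℝ (StrongDual ℝ X)) (NormedSpace.inclusionInDoubleDualLi ℝ)
      fun δ hδ => ?_
    obtain ⟨C, hC⟩ := hp δ hδ
    obtain ⟨x, -, hx⟩ := C.exists_norm_sub_inclusionInDoubleDual_le (φ := φ) hδ.le
      fun x' => by linarith [hφ x', (abs_le.1 (hC x')).1]
    exact ⟨x, hx⟩
  let C₀ : Set X := {x | ∀ x' : StrongDual ℝ X, x' x ≤ p x'}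
  -- Hahn–Banach for the sublinear `p`: extend `c • x' ↦ c * p x'` below `p`; the extension is
  -- evaluation at a point of `C₀`.
  have hattain : ∀ x', ∃ x ∈ C₀, x' x = p x' := by
    intro x'
    obtain ⟨g, hgx', hg⟩ : ∃ g : StrongDual ℝ X →ₗ[ℝ] ℝ, g x' = p x' ∧ ∀ y', g y' ≤ p y' := by
      by_cases hx' : x' = 0
      · obtain ⟨g, -, hg⟩ := exists_extension_of_le_sublinear (⊥ : StrongDual ℝ X →ₗ.[ℝ] ℝ) p
          (fun c hc => hp_smul c hc.le) hp_add (fun y => by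
            obtain ⟨y, hy⟩ := y
            obtain rfl : y = 0 := hy
            rw [hp_zero]
            exact (map_zero (⊥ : StrongDual ℝ X →ₗ.[ℝ] ℝ).toFun).le)
        exact ⟨g, by rw [hx', map_zero, hp_zero], hg⟩
      · obtain ⟨g, hgf, hg⟩ := exists_extension_of_le_sublinear
          (LinearPMap.mkSpanSingleton x' (p x') hx') p
          (fun c hc => hp_smul c hc.le) hp_add (by
            rintro ⟨y, hy⟩
            obtain ⟨c, rfl⟩ := Submodule.mem_span_singleton.1 hy
            refine (LinearPMap.mkSpanSingleton'_apply (σ := RingHom.id ℝ) x' (p x') _ c hy).trans_le ?_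
            change c * p x' ≤ p (c • x')
            rcases le_total 0 c with hc | hc
            · exact (hp_smul c hc x').ge
            · have h₁ := hp_add (c • x') ((-c) • x')
              have h₂ : c • x' + (-c) • x' = 0 := by ext; simp
              rw [h₂, hp_zero, hp_smul (-c) (by linarith)] at h₁
              linarith)
        refine ⟨g, ?_, hg⟩
        exact (hgf ⟨x', Submodule.mem_span_singleton_self x'⟩).trans
          (LinearPMap.mkSpanSingleton'_apply_self (σ := RingHom.id ℝ) x' (p x') _ _)
    obtain ⟨x, hx⟩ := hKrange (g.mkContinuous R (habs g hg)) hg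
    have hx_eval : ∀ y' : StrongDual ℝ X, y' x = g y' := fun y' =>
      congrArg (fun φ : StrongDual ℝ (StrongDual ℝ X) => φ y') hx
    exact ⟨x, fun y' => (hx_eval y').trans_le (hg y'), (hx_eval x').trans hgx'⟩
  have hcompact : IsCompact (toWeakSpace ℝ X '' C₀) := by
    have : toWeakSpace ℝ X '' C₀ = J ⁻¹' K := by
      refine Subset.antisymm (image_subset_iff.2 fun x hx => hx) fun y hy => ?_
      exact ⟨(toWeakSpace ℝ X).symm y, hy, (toWeakSpace ℝ X).apply_symm_apply y⟩
    rw [this]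
    refine (NormedSpace.isEmbedding_inclusionInDoubleDualWeak ℝ X).isCompact_preimage' hKc ?_
    intro φ hφ
    obtain ⟨x, hx⟩ := hKrange (WeakDual.toStrongDual φ) hφ
    exact ⟨toWeakSpace ℝ X x, hx⟩
  have hconv : Convex ℝ C₀ := by
    have : C₀ = ⋂ x' : StrongDual ℝ X, {x | x' x ≤ p x'} := by ext x; simp [C₀]
    rw [this]
    exact convex_iInter fun x' => convex_halfSpace_le x'.toLinearMap.isLinear _
  obtain ⟨x₀, hx₀, -⟩ := hattain 0
  refine ⟨⟨C₀, ⟨x₀, hx₀⟩, hconv, hcompact⟩, fun x' => le_antisymm ?_ ?_⟩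
  · exact Cwk.supportFun_le _ fun x hx => hx x'
  · obtain ⟨x, hx, hxp⟩ := hattain x'
    rw [← hxp]
    exact Cwk.le_supportFun ⟨C₀, ⟨x₀, hx₀⟩, hconv, hcompact⟩ x' hx

end

/-! ### Transfer to the multifunction -/

theorem exists_dual_radstromEmbedding {X : Type*} [NormedAddCommGroup X] [NormedSpace ℝ X]
    (x' : StrongDual ℝ X) :
    ∃ y' : StrongDual ℝ (lp (fun _ : Metric.closedBall (0 : StrongDual ℝ X) 1 => ℝ) ∞),
      ‖y'‖ ≤ ‖x'‖ ∧ ∀ C : Cwk X, y' (radstromEmbedding C) = supportFun x' C.1 := by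
  have hu : ‖‖x'‖⁻¹ • x'‖ ≤ 1 := by
    rw [norm_smul, norm_inv, norm_norm]
    exact inv_mul_le_one
  let u : Metric.closedBall (0 : StrongDual ℝ X) 1 :=
    ⟨‖x'‖⁻¹ • x', mem_closedBall_zero_iff.2 hu⟩
  have hx' : ‖x'‖ • u.1 = x' := by
    by_cases h : ‖x'‖ = 0
    · rw [h, zero_smul, norm_eq_zero.1 h]
    · exact smul_inv_smul₀ h x'
  -- Evaluation at the normalized `x'`, rescaled; for `x' = 0` it is the zero functional.
  refine ⟨‖x'‖ • lp.evalCLM ℝ (fun _ : Metric.closedBall (0 : StrongDual ℝ X) 1 => ℝ) ∞ u,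
    ?_, fun C => ?_⟩
  · rw [norm_smul, norm_norm]
    refine mul_le_of_le_one_right (norm_nonneg _) ?_
    exact ContinuousLinearMap.opNorm_le_bound _ zero_le_one fun f => by
      rw [one_mul]
      exact lp.norm_apply_le_norm ENNReal.top_ne_zero f u
  · have h := supportFun_smul (norm_nonneg x') u.1 C.1
    rw [hx'] at h
    exact h.symm

/-- `I` is not assumed to lie in `cwk(X)`, so `j I` may have no meaning. The vector `v` is instead
the limit of `j D` over sets `D` in `cwk(X)` approaching `I`. -/
theorem exists_hasSimpleBirkhoffIntegral {T X Y : Type*} [MeasurableSpace T] [Nonempty T]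
    [NormedAddCommGroup X] [NormedSpace ℝ X] [NormedAddCommGroup Y] [NormedSpace ℝ Y]
    [CompleteSpace Y] {μ : Measure T} {𝒞 : Set (Set X)} {F : T → Cwk X} {j : Cwk X → Y}
    (hj : ∀ α β : ℝ, 0 ≤ α → 0 ≤ β → ∀ A C D : Cwk X,
      D.1 = α • A.1 + β • C.1 → j D = α • j A + β • j C)
    (hjd : ∀ A C : Cwk X, ‖j A - j C‖ ≤ Metric.hausdorffDist A.1 C.1)
    (hF : IsSimpleBirkhoffIntegrable μ 𝒞 fun t => (F t).1) :
    ∃ v, HasSimpleBirkhoffIntegral μ (fun t => j (F t)) v := by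
  obtain ⟨I, -, -, hI⟩ := hF
  have hsum : ∀ B t n, ∃ D : Cwk X, (Metric.hausdorffEDist D.1 I =
      Metric.hausdorffEDist (riemannSum μ (fun t => (F t).1) B t n) I) ∧
      j D = ∑ i ∈ Finset.range n, μ.real (B i) • j (F (t i)) := fun B t n => by
    obtain ⟨D, hD, hjD⟩ := Cwk.exists_sum hj (Finset.range n)
      (c := fun i => μ.real (B i)) (fun i => measureReal_nonneg) fun i => F (t i)
    exact ⟨D, by rw [riemannSum, Metric.hausdorffEDist_closure_left, hD], hjD⟩
  have hdist : ∀ (D D' : Cwk X) {r r' : ℝ}, 0 ≤ r → 0 ≤ r' →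
      Metric.hausdorffEDist D.1 I ≤ ENNReal.ofReal r →
      Metric.hausdorffEDist D'.1 I ≤ ENNReal.ofReal r' → ‖j D - j D'‖ ≤ r + r' := by
    intro D D' r r' hr hr' h h'
    refine (hjd D D').trans (ENNReal.toReal_le_of_le_ofReal (add_nonneg hr hr') ?_)
    rw [ENNReal.ofReal_add hr hr']
    refine Metric.hausdorffEDist_triangle.trans (add_le_add h ?_)
    rwa [Metric.hausdorffEDist_comm]
  have hclose : ∀ ε : ℝ, 0 < ε → ∃ A : ℕ → Set T, IsCountablePartition A ∧ (∀ n, μ (A n) < ∞) ∧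
      ∀ B, IsCountablePartition B → IsFinerThan B A → ∀ t, IsTagging t B →
        ∀ᶠ n in atTop, Metric.hausdorffEDist (riemannSum μ (fun t => (F t).1) B t n) I
          ≤ ENNReal.ofReal ε := by
    intro ε hε
    -- Halving leaves room to pass from the `limsup` to an eventual bound.
    obtain ⟨A, hA, hfin, h⟩ := hI (ε / 2) (half_pos hε)
    refine ⟨A, hA, hfin, fun B hB hBA t ht => ?_⟩
    have hlt : ENNReal.ofReal (ε / 2) < ENNReal.ofReal ε :=
      (ENNReal.ofReal_lt_ofReal_iff hε).2 (half_lt_self hε)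
    exact (eventually_lt_of_limsup_lt ((h B hB hBA t ht).trans_lt hlt)).mono fun _ => le_of_lt
  have happrox : ∀ ε : ℝ, 0 < ε → ∃ D : Cwk X,
      Metric.hausdorffEDist D.1 I ≤ ENNReal.ofReal ε := by
    intro ε hε
    obtain ⟨A, hA, -, h⟩ := hclose ε hε
    obtain ⟨t, ht⟩ := exists_isTagging A
    obtain ⟨n, hn⟩ := (h A hA (.refl A) t ht).exists
    obtain ⟨D, hD, -⟩ := hsum A t n
    exact ⟨D, hD.trans_le hn⟩
  have : Nonempty (Cwk X) := ⟨F (Classical.arbitrary T)⟩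
  choose! D hD using happrox
  let ε : ℕ → ℝ := fun n => 1 / (n + 1)
  have hε : ∀ n, 0 < ε n := fun n => Nat.one_div_pos_of_nat
  have hε0 : Tendsto ε atTop (nhds 0) := tendsto_one_div_add_atTop_nhds_zero_nat
  have hcau : CauchySeq fun n => j (D (ε n)) := by
    refine cauchySeq_of_le_tendsto_0 (fun n => 2 * ε n) (fun n m N hn hm => ?_) ?_
    · have h₁ : ε n ≤ ε N := Nat.one_div_le_one_div hn
      have h₂ : ε m ≤ ε N := Nat.one_div_le_one_div hm
      rw [dist_eq_norm]
      linarith [hdist _ _ (hε n).le (hε m).le (hD _ (hε n)) (hD _ (hε m))]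
    · simpa using hε0.const_mul 2
  obtain ⟨v, hv⟩ := cauchySeq_tendsto_of_complete hcau
  refine ⟨v, fun δ hδ => ?_⟩
  obtain ⟨A, hA, hfin, h⟩ := hclose δ hδ
  refine ⟨A, hA, hfin, fun B hB hBA t ht => ?_⟩
  filter_upwards [h B hB hBA t ht] with n hn
  obtain ⟨E, hE, hjE⟩ := hsum B t n
  rw [← hjE]
  have hlim : Tendsto (fun n => δ + ε n) atTop (nhds δ) := by simpa using hε0.const_add δ
  exact le_of_tendsto_of_tendsto' (hv.const_sub (j E)).norm hlim fun m =>
    hdist E (D (ε m)) hδ.le (hε m).le (hE.trans_le hn) (hD _ (hε m))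

theorem isPettisIntegrable_of_isEmpty {T Y : Type*} [MeasurableSpace T] [IsEmpty T]
    [NormedAddCommGroup Y] [NormedSpace ℝ Y] (μ : Measure T) (f : T → Y) :
    IsPettisIntegrable μ f := by
  rw [Measure.eq_zero_of_isEmpty μ]
  exact ⟨fun y' => integrable_zero_measure, fun A _ => ⟨0, fun y' => by simp⟩⟩

theorem IsSimpleBirkhoffIntegrable.isPettisIntegrable_comp {T X Y : Type*} [MeasurableSpace T]
    [NormedAddCommGroup X] [NormedSpace ℝ X] [NormedAddCommGroup Y] [NormedSpace ℝ Y]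
    [CompleteSpace Y] {μ : Measure T} {𝒞 : Set (Set X)} {F : T → Cwk X} {j : Cwk X → Y}
    (hF : IsSimpleBirkhoffIntegrable μ 𝒞 fun t => (F t).1)
    (hj : ∀ α β : ℝ, 0 ≤ α → 0 ≤ β → ∀ A C D : Cwk X,
      D.1 = α • A.1 + β • C.1 → j D = α • j A + β • j C)
    (hjd : ∀ A C : Cwk X, ‖j A - j C‖ ≤ Metric.hausdorffDist A.1 C.1) :
    IsPettisIntegrable μ fun t => j (F t) := by
  rcases isEmpty_or_nonempty T with hT | hT
  · exact isPettisIntegrable_of_isEmpty μ _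
  · obtain ⟨v, hv⟩ := exists_hasSimpleBirkhoffIntegral hj hjd hF
    exact hv.isPettisIntegrable

theorem IsSimpleBirkhoffIntegrable.isMultiPettisIntegrable {T X : Type*} [MeasurableSpace T]
    [NormedAddCommGroup X] [NormedSpace ℝ X] [CompleteSpace X] {μ : Measure T}
    {𝒞 : Set (Set X)} {F : T → Cwk X}
    (hF : IsSimpleBirkhoffIntegrable μ 𝒞 fun t => (F t).1) :
    IsMultiPettisIntegrable μ F := by
  have hj : ∀ α β : ℝ, 0 ≤ α → 0 ≤ β → ∀ A C D : Cwk X, D.1 = α • A.1 + β • C.1 →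
      radstromEmbedding D = α • radstromEmbedding A + β • radstromEmbedding C :=
    fun _ _ hα hβ _ _ _ hD => radstromEmbedding_combination hα hβ hD
  have hint := (hF.isPettisIntegrable_comp hj norm_radstromEmbedding_sub_le).1
  refine ⟨fun x' => ?_, fun E hE => Cwk.exists_supportFun_eq fun ε hε => ?_⟩
  · obtain ⟨y', -, hy'⟩ := exists_dual_radstromEmbedding x'
    simpa only [hy'] using hint y'
  · rcases isEmpty_or_nonempty T with hT | hT
    · obtain ⟨D, hD⟩ := Cwk.exists_zero (X := X)
      refine ⟨D, fun x' => ?_⟩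
      rw [Measure.eq_zero_of_isEmpty μ, hD]
      simp only [supportFun, ← singleton_zero, image_singleton, map_zero, csSup_singleton,
        Measure.restrict_zero, integral_zero_measure, sub_zero, abs_zero]
      positivity
    · obtain ⟨v, hv⟩ := exists_hasSimpleBirkhoffIntegral hj norm_radstromEmbedding_sub_le hF
      -- The combination is independent of the functional, so a single set `D` serves all `x'`.
      obtain ⟨S, c, t, hc, h⟩ := hv.exists_approx hE hε
      obtain ⟨D, -, hD⟩ := Cwk.exists_sum hj S hc fun i => F (t i)
      refine ⟨D, fun x' => ?_⟩
      obtain ⟨y', hnorm, hy'⟩ := exists_dual_radstromEmbedding x'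
      have h' := h y'
      rw [← hD] at h'
      simp only [hy'] at h'
      exact h'.trans (by gcongr)

theorem corollary3p16 {T : Type*} [MeasurableSpace T] (μ : Measure T) [SigmaFinite μ]
    {X : Type*} [NormedAddCommGroup X] [NormedSpace ℝ X] [CompleteSpace X]
    (𝒞 : Set (Set X)) (h𝒞 : 𝒞 ⊆ boundedSets X) (F : T → Cwk X)
    (hF : IsSimpleBirkhoffIntegrable μ 𝒞 (fun t => (F t).1)) :
    IsPettisIntegrable μ (fun t => radstromEmbedding (F t)) ∧
      (∀ (Ω : Type*) [TopologicalSpace Ω] [CompactSpace Ω] [T2Space Ω] (j : Cwk X → C(Ω, ℝ)),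
        IsRadstromEmbedding j → IsPettisIntegrable μ (fun t => j (F t))) ∧
      IsMultiPettisIntegrable μ F := by
  refine ⟨hF.isPettisIntegrable_comp ?_ norm_radstromEmbedding_sub_le, ?_,
    hF.isMultiPettisIntegrable⟩
  · exact fun _ _ hα hβ _ _ _ hD => radstromEmbedding_combination hα hβ hD
  · intro Ω _ _ _ j hj
    exact hF.isPettisIntegrable_comp hj.map_combination fun A C => (hj.isometry A C).ge
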